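/- Let $A$ be a commutative ring with unit, $S$ a finite set with $n$ elements, and $\mathcal P(S)$ the power set of $S$, ordered by inclusion. An $S$-cube of $A$-modules is a contravariant functor $x$ from $\mathcal P(S)$ to $A$-modules; write $x_T$ for its value at $T\subseteq S$ and $d_T^t\colon x_T\to x_{T\smallsetminus\{t\}}$, $t\in T$, for its boundary maps. For an $A$-module $M$, a sequence $f_1,\dots,f_q$ in $A$ is $M$-regular if every $f_i$ is a non-unit and, for every $1\le i\le q$, multiplication by $f_i$ is injective on $M/(f_1,\dots,f_{i-1})M$. A finite family of elements of $A$ is an $M$-sequence if it is $M$-regular in every ordering. A regular adjugate of $x$ consists of elements $a_s\in A$ ($s\in S$) and homomorphisms $d_T^{t*}\colon x_{T\smallsetminus\{t\}}\to x_T$ ($t\in T\subseteq S$) such that 1. $d_T^t d_T^{t*}=a_t\,\mathrm{id}$ and $d_T^{t*}d_T^t=a_t\,\mathrm{id}$ for all $t\in T\subseteq S$; 2. $d_T^b d_T^{a*}=d_{T\smallsetminus\{b\}}^{a*}\,d_{T\smallsetminus\{a\}}^b$ for all $T\subseteq S$ and distinct $a,b\in T$; 3. $(a_s)_{s\in S}$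 is an $x_T$-sequence for every $T\subseteq S$. Fix a bijection of $S$ with $\{1,\dots,n\}$. The total complex $\operatorname{Tot}x$ is the complex $0\to F_n\xrightarrow{\varphi_n}\cdots\xrightarrow{\varphi_1}F_0\to 0$ with $F_k=\bigoplus_{\#T=k}x_T$, where the component of $\varphi_k$ from $x_T$ to $x_{T\smallsetminus\{j\}}$, $j\in T$, is $(-1)^{\#\{t\in T:\,t>j\}}d_T^j$ and all other components are zero. For a homomorphism $\varphi$ of free $A$-modules of finite rank, $I_t(\varphi)$ is the ideal generated by the $t\times t$ minors of a matrix of $\varphi$. For an ideal $I$ of $A$, $\operatorname{grade} I\in\{0,1,2,\dots,\infty\}$ is the supremum of the lengths of the $A$-regular sequences of elements of $I$. **Proposition.** Let $x$ be an $S$-cube of free $A$-modules of finite rank, all vertices $x_T$ having the same rank $m\ge 1$, and suppose that $x$ admits a regular adjugate. Then $\operatorname{Tot}x$ satisfies $$\operatorname{grade} I_{r_i}(\varphi_i)\ \ge\ i\qquad\text{for all }1\le i\le n,\qquad\text{where } r_i=\sum_{j=i}^{n}(-1)^{j-i}\operatorname{rank}F_j .$$ -/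

import Mathlib

open CategoryTheory Opposite DirectSum

universe u v w

/-! ## Regular sequences, grade -/

/-- A sequence `f₁, …, f_q` in `A` is `M`-regular if every `fᵢ` is a non-unit of `A` and, for every
`i`, multiplication by `f_{i+1}` is injective on `M / (f₁, …, fᵢ) M`. The quotients are allowed to
vanish. -/
def IsRegSeq {A : Type u} [CommRing A] (M : Type v) [AddCommGroup M] [Module A M]
    (l : List A) : Prop :=
  (∀ f ∈ l, ¬ IsUnit f) ∧ RingTheory.Sequence.IsWeaklyRegular M l

/-- A finite family of elements of `A` is an `M`-sequence if it is an `M`-regular sequence in every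
ordering of its members. -/
def IsUnorderedRegSeq {A : Type u} [CommRing A] (M : Type v) [AddCommGroup M] [Module A M]
    {S : Type w} [Fintype S] (a : S → A) : Prop :=
  ∀ e : Fin (Fintype.card S) ≃ S, IsRegSeq M (List.ofFn fun i => a (e i))

/-- The set of the lengths of the `A`-regular sequences with members in the ideal `I`. -/
def regSeqLengths {A : Type u} [CommRing A] (I : Ideal A) : Set ℕ :=
  {n | ∃ f : Fin n → A, (∀ i, f i ∈ I) ∧ IsRegSeq A (List.ofFn f)}

/-- The grade of an ideal: the supremum in `ℕ∞` of the lengths of the `A`-regular sequences in `I`.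
The supremum is the maximum of a non-empty finite set, `⊤` for an infinite set, `0` for `∅`. -/
noncomputable def idealGrade {A : Type u} [CommRing A] (I : Ideal A) : ℕ∞ :=
  ⨆ n ∈ regSeqLengths I, (n : ℕ∞)

/-! ## Fitting ideals -/

/-- The ideal generated by the `t`-minors of a matrix. (Rows and columns are selected by injections
rather than by subsets: this changes a minor at most by its sign.) For `t = 0` it is the unit
ideal. -/
def minorIdeal {A : Type u} [CommRing A] {m n : Type*} (t : ℕ) (U : Matrix m n A) : Ideal A :=
  Ideal.span {a | ∃ (r : Fin t ↪ m) (c : Fin t ↪ n), a = (U.submatrix r c).det}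

open Classical in
/-- The `t`-th Fitting ideal of a homomorphism of free modules of finite rank: the ideal of
`t`-minors of a matrix representing it. It does not depend on the bases, see
`fittingIdeal_eq_minorIdeal`. -/
noncomputable def fittingIdeal {A : Type u} [CommRing A] {M N : Type*}
    [AddCommGroup M] [Module A M] [Module.Free A M] [Module.Finite A M]
    [AddCommGroup N] [Module A N] [Module.Free A N] [Module.Finite A N]
    (t : ℕ) (φ : M →ₗ[A] N) : Ideal A :=
  minorIdeal t (LinearMap.toMatrix (Module.Free.chooseBasis A M) (Module.Free.chooseBasis A N) φ)

theorem det_submatrix_mem_minorIdeal {A : Type u} [CommRing A] {m n : Type*} (t : ℕ)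
    (U : Matrix m n A) (r : Fin t → m) (c : Fin t → n) :
    (U.submatrix r c).det ∈ minorIdeal t U := by
  by_cases hr : Function.Injective r
  · by_cases hc : Function.Injective c
    · exact Ideal.subset_span ⟨⟨r, hr⟩, ⟨c, hc⟩, rfl⟩
    · simp only [Function.Injective, not_forall] at hc
      obtain ⟨i, j, hij, hne⟩ := hc
      rw [Matrix.det_zero_of_column_eq hne (fun k => by simp [hij])]
      exact zero_mem _
  · simp only [Function.Injective, not_forall] at hr
    obtain ⟨i, j, hij, hne⟩ := hr
    rw [Matrix.det_zero_of_row_eq hne (by ext k; simp [hij])]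
    exact zero_mem _

theorem minorIdeal_transpose {A : Type u} [CommRing A] {m n : Type*} (t : ℕ) (U : Matrix m n A) :
    minorIdeal t U.transpose = minorIdeal t U := by
  unfold minorIdeal
  congr 1
  ext a
  constructor <;> rintro ⟨r, c, rfl⟩ <;> refine ⟨c, r, ?_⟩ <;>
    rw [← Matrix.det_transpose] <;> rfl

theorem minorIdeal_mul_le_right {A : Type u} [CommRing A] {l m n : Type*} [Fintype m] (t : ℕ)
    (P : Matrix l m A) (U : Matrix m n A) : minorIdeal t (P * U) ≤ minorIdeal t U := by
  classical
  refine Ideal.span_le.2 ?_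
  rintro _ ⟨r, c, rfl⟩
  have h : ((P * U).submatrix r c).det =
      Matrix.detRowAlternating (fun i => ∑ k, P (r i) k • (fun j => U k (c j))) := by
    rw [Matrix.detRowAlternating]
    change Matrix.det _ = Matrix.det _
    congr 1
    ext i j
    simp [Matrix.mul_apply]
  rw [SetLike.mem_coe, h, ← AlternatingMap.coe_multilinearMap, MultilinearMap.map_sum]
  refine sum_mem fun k _ => ?_
  rw [MultilinearMap.map_smul_univ]
  exact Ideal.mul_mem_left _ _ (det_submatrix_mem_minorIdeal t U k c)

theorem minorIdeal_mul_le_left {A : Type u} [CommRing A] {l m n : Type*} [Fintype m] (t : ℕ)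
    (U : Matrix l m A) (Q : Matrix m n A) : minorIdeal t (U * Q) ≤ minorIdeal t U := by
  rw [← minorIdeal_transpose, Matrix.transpose_mul, ← minorIdeal_transpose t U]
  exact minorIdeal_mul_le_right t _ _

/-- The Fitting ideals may be computed in any bases. -/
theorem fittingIdeal_eq_minorIdeal {A : Type u} [CommRing A] {M N : Type*}
    [AddCommGroup M] [Module A M] [Module.Free A M] [Module.Finite A M]
    [AddCommGroup N] [Module A N] [Module.Free A N] [Module.Finite A N]
    {m n : Type*} [Fintype m] [DecidableEq m] [Fintype n] [DecidableEq n]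
    (b : Module.Basis m A M) (c : Module.Basis n A N) (t : ℕ) (φ : M →ₗ[A] N) :
    fittingIdeal t φ = minorIdeal t (LinearMap.toMatrix b c φ) := by
  classical
  unfold fittingIdeal
  apply le_antisymm
  · rw [← basis_toMatrix_mul_linearMap_toMatrix_mul_basis_toMatrix
      (Module.Free.chooseBasis A M) b (Module.Free.chooseBasis A N) c]
    exact (minorIdeal_mul_le_left t _ _).trans (minorIdeal_mul_le_right t _ _)
  · rw [← basis_toMatrix_mul_linearMap_toMatrix_mul_basis_toMatrix
      b (Module.Free.chooseBasis A M) c (Module.Free.chooseBasis A N)]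
    exact (minorIdeal_mul_le_left t _ _).trans (minorIdeal_mul_le_right t _ _)

/-! ## The grade condition for complexes of free modules -/

/-- `r_i = ∑_{j = i}^{s} (-1)^{j - i} rank F_j`, for a complex `0 → F_s → ⋯ → F_0 → 0`. -/
noncomputable def altRank {A : Type u} [CommRing A] (F : ChainComplex (ModuleCat.{v} A) ℕ)
    (s i : ℕ) : ℤ :=
  ∑ j ∈ Finset.Icc i s, (-1) ^ (j - i) * (Module.finrank A (F.X j) : ℤ)

/-- The grade condition on a complex `0 → F_s → ⋯ → F_0 → 0` of free modules of finite
rank: `grade I_{r_i}(φ_i) ≥ i` for `1 ≤ i ≤ s`, where `φ_i : F_i → F_{i-1}` is the boundary map.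
(`toNat` follows the convention that `I_r` is the unit ideal for `r ≤ 0`.) -/
def GradeCondition {A : Type u} [CommRing A] (F : ChainComplex (ModuleCat.{v} A) ℕ)
    [∀ k, Module.Free A (F.X k)] [∀ k, Module.Finite A (F.X k)] (s : ℕ) : Prop :=
  ∀ i : ℕ, 1 ≤ i → i ≤ s →
    (i : ℕ∞) ≤ idealGrade (fittingIdeal (altRank F s i).toNat (F.d i (i - 1)).hom)

/-! ## Cubes -/

/-- An `S`-cube in `C`: a contravariant functor to `C` from the poset of the subsets of `S`. -/
abbrev Cube (S : Type w) (C : Type u) [Category.{v} C] := (Finset S)ᵒᵖ ⥤ C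

namespace Cube

/-- The vertex `x_T`. -/
abbrev vertex {S : Type w} {C : Type u} [Category.{v} C] (x : Cube S C) (T : Finset S) : C :=
  x.obj (op T)

/-- The morphism `x_T ⟶ x_U` for `U ⊆ T`. -/
abbrev res {S : Type w} {C : Type u} [Category.{v} C] (x : Cube S C) {U T : Finset S}
    (h : U ⊆ T) : x.vertex T ⟶ x.vertex U :=
  x.map (homOfLE h).op

/-- The boundary morphism `d_T^t : x_T ⟶ x_{T ∖ {t}}` (considered for `t ∈ T`). -/
abbrev bdry {S : Type w} [DecidableEq S] {C : Type u} [Category.{v} C] (x : Cube S C)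
    (T : Finset S) (t : S) : x.vertex T ⟶ x.vertex (T.erase t) :=
  x.res (Finset.erase_subset t T)

end Cube

/-- An adjugate of an `S`-cube `x` in an `A`-linear category: a family `a` of elements of `A` and
morphisms `d_T^{t*} : x_{T ∖ {t}} ⟶ x_T` for `t ∈ T`, such that (`≫` is composition in diagrammatic
order)
* `d_T^t d_T^{t*} = a_t` on `x_{T ∖ {t}}` and `d_T^{t*} d_T^t = a_t` on `x_T`;
* `d_T^b d_T^{a*} = d_{T ∖ {b}}^{a*} d_{T ∖ {a}}^b` for distinct `a, b ∈ T`. -/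
structure CubeAdjugate (A : Type*) [CommRing A] {S : Type w} [DecidableEq S] {C : Type u}
    [Category.{v} C] [Preadditive C] [Linear A C] (x : Cube S C) where
  /-- the elements `a_s` -/
  a : S → A
  /-- the morphisms `d_T^{t*}` -/
  dstar : ∀ (T : Finset S) (t : S), t ∈ T → (x.vertex (T.erase t) ⟶ x.vertex T)
  dstar_bdry : ∀ (T : Finset S) (t : S) (ht : t ∈ T),
    dstar T t ht ≫ x.bdry T t = a t • 𝟙 (x.vertex (T.erase t))
  bdry_dstar : ∀ (T : Finset S) (t : S) (ht : t ∈ T),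
    x.bdry T t ≫ dstar T t ht = a t • 𝟙 (x.vertex T)
  /-- The morphism `x.res _` is `d_{T ∖ {p}}^q`, with its target `x_{(T ∖ {p}) ∖ {q}}` written
  as `x_{(T ∖ {q}) ∖ {p}}`. -/
  dstar_comm : ∀ (T : Finset S) (p q : S) (hp : p ∈ T) (_ : q ∈ T) (hpq : p ≠ q),
    dstar T p hp ≫ x.bdry T q =
      x.res (Finset.erase_subset_erase p (Finset.erase_subset q T)) ≫
        dstar (T.erase q) p (Finset.mem_erase.2 ⟨hpq, hp⟩)

/-- An adjugate of a cube of `A`-modules is regular if `a` is an `x_T`-sequence for every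
`T ⊆ S`. -/
def CubeAdjugate.IsRegular {A : Type u} [CommRing A] {S : Type w} [Fintype S] [DecidableEq S]
    {x : Cube S (ModuleCat.{v} A)} (𝔄 : CubeAdjugate A x) : Prop :=
  ∀ T : Finset S, IsUnorderedRegSeq (x.vertex T) 𝔄.a

/-! ## The total complex -/

namespace Cube

/-- The degree `k` component of the total complex: the direct sum of the `x_T` with `#T = k`. -/
abbrev TotX {A : Type u} [CommRing A] {S : Type w} (x : Cube S (ModuleCat.{v} A)) (k : ℕ) :
    Type (max w v) :=
  ⨁ T : {T : Finset S // T.card = k}, x.vertex T.1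

/-- The sign `(-1)^{#{t ∈ T | t > j}}`, where `S` is ordered through `α : S ≃ {0, …, n - 1}`. -/
def totSign (A : Type u) [CommRing A] {S : Type w} [Fintype S]
    (α : S ≃ Fin (Fintype.card S)) (T : Finset S) (j : S) : A :=
  (-1) ^ (T.filter fun t => α j < α t).card

/-- The boundary map of the total complex. On the summand `x_T` its component to `x_{T ∖ {j}}`,
`j ∈ T`, is `(-1)^{#{t ∈ T | t > j}} d_T^j`; the other components are zero. -/
noncomputable def totD {A : Type u} [CommRing A] {S : Type w} [Fintype S] [DecidableEq S]
    (α : S ≃ Fin (Fintype.card S)) (x : Cube S (ModuleCat.{v} A)) (k : ℕ) :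
    x.TotX (k + 1) →ₗ[A] x.TotX k :=
  DirectSum.toModule A _ _ fun T : {T : Finset S // T.card = k + 1} =>
    ∑ j : {j : S // j ∈ T.1}, totSign A α T.1 j.1 •
      (DirectSum.lof A {T : Finset S // T.card = k} (fun U => x.vertex U.1)
        ⟨T.1.erase j.1, by rw [Finset.card_erase_of_mem j.2, T.2]; rfl⟩ ∘ₗ
          (x.bdry T.1 j.1).hom)

theorem totSign_mul_add {A : Type u} [CommRing A] {S : Type w} [Fintype S] [DecidableEq S]
    (α : S ≃ Fin (Fintype.card S)) (T : Finset S) {j k : S} (hj : j ∈ T) (hk : k ∈ T)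
    (hjk : j ≠ k) :
    totSign A α T j * totSign A α (T.erase j) k + totSign A α T k * totSign A α (T.erase k) j
      = 0 := by
  wlog h : α j < α k generalizing j k
  · rw [add_comm]
    exact this hk hj hjk.symm (lt_of_le_of_ne (not_lt.1 h) fun e => hjk (α.injective e).symm)
  have h1 : (T.erase j).filter (fun t => α k < α t) = T.filter (fun t => α k < α t) := by
    ext t
    simp only [Finset.mem_filter, Finset.mem_erase]
    refine ⟨fun ⟨⟨_, a⟩, b⟩ => ⟨a, b⟩, fun ⟨a, b⟩ => ⟨⟨?_, a⟩, b⟩⟩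
    rintro rfl
    exact lt_asymm h b
  have h2 : ((T.erase k).filter (fun t => α j < α t)).card + 1 =
      (T.filter (fun t => α j < α t)).card := by
    rw [← Finset.card_erase_add_one (Finset.mem_filter.2 ⟨hk, h⟩)]
    congr 2
    ext t
    simp only [Finset.mem_filter, Finset.mem_erase, and_assoc]
  unfold totSign
  rw [h1, ← h2]
  ring

theorem totD_comp_totD {A : Type u} [CommRing A] {S : Type w} [Fintype S] [DecidableEq S]
    (α : S ≃ Fin (Fintype.card S)) (x : Cube S (ModuleCat.{v} A)) (k : ℕ) :
    x.totD α k ∘ₗ x.totD α (k + 1) = 0 := by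
  refine DirectSum.linearMap_ext A fun T => LinearMap.ext fun v => ?_
  have hcard : ∀ j ∈ T.1, ∀ l ∈ T.1.erase j, ((T.1.erase j).erase l).card = k := by
    intro j hj l hl
    rw [Finset.card_erase_of_mem hl, Finset.card_erase_of_mem hj, T.2]
    rfl
  let g : ∀ U : Finset S, U ⊆ T.1 → U.card = k → x.TotX k := fun U hU hc =>
    DirectSum.lof A {T : Finset S // T.card = k} (fun U => x.vertex U.1) ⟨U, hc⟩ ((x.res hU).hom v)
  have hg : ∀ (U V : Finset S) (hU hV hc hc'), U = V → g U hU hc = g V hV hc' := by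
    rintro U _ hU hV hc hc' rfl
    rfl
  have hres : ∀ (j l : S), (x.bdry (T.1.erase j) l).hom ((x.bdry T.1 j).hom v) =
      (x.res ((Finset.erase_subset l _).trans (Finset.erase_subset j T.1))).hom v := by
    intro j l
    rw [← ModuleCat.comp_apply, ← x.map_comp]
    rfl
  have key : (x.totD α k ∘ₗ x.totD α (k + 1)) (DirectSum.lof A _ _ T v) =
      ∑ j : {j : S // j ∈ T.1}, ∑ l : {l : S // l ∈ T.1.erase j.1},
        (totSign A α T.1 j.1 * totSign A α (T.1.erase j.1) l.1) •
          g ((T.1.erase j.1).erase l.1)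
            ((Finset.erase_subset l.1 _).trans (Finset.erase_subset j.1 T.1))
            (hcard _ j.2 _ l.2) := by
    simp only [totD, LinearMap.comp_apply, DirectSum.toModule_lof, LinearMap.sum_apply, map_sum,
      LinearMap.smul_apply, map_smul, Finset.smul_sum, smul_smul]
    refine Finset.sum_congr rfl fun j _ => Finset.sum_congr rfl fun l _ => ?_
    rw [hres]
  rw [LinearMap.comp_apply, key, Finset.sum_sigma']
  simp only [LinearMap.comp_apply, LinearMap.zero_apply]
  refine Finset.sum_involution
    (fun p _ => ⟨⟨p.2.1, Finset.mem_of_mem_erase p.2.2⟩,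
      ⟨p.1.1, Finset.mem_erase.2 ⟨(Finset.ne_of_mem_erase p.2.2).symm, p.1.2⟩⟩⟩) ?_ ?_ ?_ ?_
  · rintro ⟨⟨j, hj⟩, ⟨l, hl⟩⟩ _
    have hl' := Finset.mem_erase.1 hl
    dsimp only
    rw [hg _ _ _ ((Finset.erase_subset l _).trans (Finset.erase_subset j T.1)) _
      (hcard _ hj _ hl) (Finset.erase_right_comm (s := T.1) (a := l) (b := j)), ← add_smul,
      totSign_mul_add α T.1 hj hl'.2 (Ne.symm hl'.1), zero_smul]
  · rintro ⟨⟨j, hj⟩, ⟨l, hl⟩⟩ _ _ h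
    simp only [Sigma.mk.injEq, Subtype.mk.injEq] at h
    exact (Finset.mem_erase.1 hl).1 h.1
  · intros
    exact Finset.mem_sigma.2 ⟨Finset.mem_univ _, Finset.mem_univ _⟩
  · intros
    rfl

/-- The total complex of an `S`-cube of `A`-modules. -/
noncomputable def Tot {A : Type u} [CommRing A] {S : Type w} [Fintype S] [DecidableEq S]
    (α : S ≃ Fin (Fintype.card S)) (x : Cube S (ModuleCat.{v} A)) :
    ChainComplex (ModuleCat.{max w v} A) ℕ :=
  ChainComplex.of (fun k => ModuleCat.of A (x.TotX k)) (fun k => ModuleCat.ofHom (x.totD α k))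
    fun k => by
      rw [← ModuleCat.ofHom_comp, totD_comp_totD]
      rfl

instance {A : Type u} [CommRing A] {S : Type w} [Fintype S] [DecidableEq S]
    (α : S ≃ Fin (Fintype.card S)) (x : Cube S (ModuleCat.{v} A))
    [∀ T, Module.Free A (x.vertex T)] (k : ℕ) : Module.Free A ((x.Tot α).X k) :=
  inferInstanceAs (Module.Free A (x.TotX k))

instance {A : Type u} [CommRing A] {S : Type w} [Fintype S] [DecidableEq S]
    (α : S ≃ Fin (Fintype.card S)) (x : Cube S (ModuleCat.{v} A))
    [∀ T, Module.Finite A (x.vertex T)] (k : ℕ) : Module.Finite A ((x.Tot α).X k) :=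
  inferInstanceAs (Module.Finite A (x.TotX k))

end Cube

/-! ## Weakly regular sequences: direct summands, extensions, powers -/

namespace RingTheory.Sequence.IsWeaklyRegular

open scoped Pointwise

variable {R : Type*} [CommRing R]

/-! Fix a direction `s`. Restrict the boundary map from degree `k + 1` to degree `k` to the summands
`x_T` with `s ∈ T`, and project it to the summands `x_{T ∖ {s}}`. The result is block diagonal with
blocks `± d_T^s`, because `T ∖ {j}` with `j ≠ s` still contains `s`. Composing with the signed
adjugate maps therefore gives `a_s • id` on a free module of rank `(n - 1).choose k * m`
(`adjProj_comp_totD_comp_starIncl`). This rank is exactly `r_{k+1}` (`altRank_tot`), so `a_s ^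
r_{k+1}` lies in the Fitting ideal for every `s`.

These `n` powers form an `A`-regular sequence. Weak regularity passes from the nonzero free module
`x_∅` to its direct summand `A` (`isWeaklyRegular_self_of_free`) and survives taking powers
(`map_pow`). Hence each of the grades is at least `n`, and so at least `i`. -/

theorem of_leftInverse {l : List R} {M N : Type*} [AddCommGroup M] [Module R M]
    [AddCommGroup N] [Module R N] (f : N →ₗ[R] M) (g : M →ₗ[R] N)
    (hgf : g ∘ₗ f = LinearMap.id) (h : IsWeaklyRegular M l) : IsWeaklyRegular N l := by
  induction l generalizing M N with
  | nil => exact .nil R N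
  | cons r l ih =>
    rw [isWeaklyRegular_cons_iff] at h ⊢
    have hf : Function.Injective f :=
      Function.LeftInverse.injective (g := g) fun x => LinearMap.congr_fun hgf x
    refine ⟨fun x y hxy => hf (h.1 ?_), ih (QuotSMulTop.map r f) (QuotSMulTop.map r g) ?_ h.2⟩
    · simpa using congrArg f hxy
    · rw [← QuotSMulTop.map_comp, hgf, QuotSMulTop.map_id]

/-- The sequence stays exact on the left modulo `r` because `M''` has no `r`-torsion: if `f y = r •
z`, then `r • g z = 0`, so `z` comes from `M'`. The induction can then continue with the quotients.
-/
theorem of_shortExact {l : List R} {M' M M'' : Type*} [AddCommGroup M'] [Module R M']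
    [AddCommGroup M] [Module R M] [AddCommGroup M''] [Module R M'']
    {f : M' →ₗ[R] M} {g : M →ₗ[R] M''} (hf : Function.Injective f) (hfg : Function.Exact f g)
    (hg : Function.Surjective g) (h' : IsWeaklyRegular M' l) (h'' : IsWeaklyRegular M'' l) :
    IsWeaklyRegular M l := by
  induction l generalizing M' M M'' with
  | nil => exact .nil R M
  | cons r l ih =>
    rw [isWeaklyRegular_cons_iff] at h' h'' ⊢
    refine ⟨isSMulRegular_of_range_eq_ker hf hfg.linearMap_ker_eq.symm h'.1 h''.1,
      ih (f := QuotSMulTop.map r f) (g := QuotSMulTop.map r g) ?_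
        (QuotSMulTop.map_exact r hfg hg) (QuotSMulTop.map_surjective r hg) h'.2 h''.2⟩
    rw [injective_iff_map_eq_zero]
    intro y hy
    obtain ⟨y, rfl⟩ := Submodule.mkQ_surjective _ y
    rw [Submodule.mkQ_apply, QuotSMulTop.map_apply_mk, Submodule.Quotient.mk_eq_zero] at hy
    obtain ⟨z, -, hz⟩ := hy
    replace hz : r • z = f y := hz
    have hgz : g z = 0 := h''.1 (by
      change r • g z = r • 0
      rw [← map_smul, hz, hfg.apply_apply_eq_zero, smul_zero])
    obtain ⟨w, rfl⟩ := (hfg z).1 hgz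
    rw [← map_smul] at hz
    rw [Submodule.mkQ_apply, Submodule.Quotient.mk_eq_zero, ← hf hz]
    exact Submodule.smul_mem_pointwise_smul _ _ _ trivial

theorem cons_pow {M : Type*} [AddCommGroup M] [Module R M] {r : R} {l : List R}
    (h : IsWeaklyRegular M (r :: l)) (k : ℕ) : IsWeaklyRegular M (r ^ (k + 1) :: l) := by
  rw [isWeaklyRegular_cons_iff] at h ⊢
  refine ⟨h.1.pow _, ?_⟩
  induction k with
  | zero => rw [zero_add, pow_one]; exact h.2
  | succ k ih =>
    have hmul : r • (⊤ : Submodule R M) ≤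
        (r ^ (k + 1 + 1) • (⊤ : Submodule R M)).comap (LinearMap.lsmul R M (r ^ (k + 1))) := by
      rintro _ ⟨z, -, rfl⟩
      refine ⟨z, trivial, ?_⟩
      simp [smul_smul, pow_succ, mul_comm]
    have hle : r ^ (k + 1 + 1) • (⊤ : Submodule R M) ≤
        (r ^ (k + 1) • (⊤ : Submodule R M)).comap LinearMap.id := by
      rintro _ ⟨z, -, rfl⟩
      refine ⟨r • z, trivial, ?_⟩
      simp [smul_smul, pow_succ, mul_comm]
    -- The sequence `0 → M/rM → M/r^(k+2)M → M/r^(k+1)M → 0`, with multiplication by `r^(k+1)`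
    -- followed by the projection.
    refine of_shortExact (f := Submodule.mapQ _ _ _ hmul) (g := Submodule.mapQ _ _ _ hle)
      ?_ ?_ ?_ h.2 ih
    · rw [injective_iff_map_eq_zero]
      intro y hy
      obtain ⟨y, rfl⟩ := Submodule.mkQ_surjective _ y
      rw [Submodule.mkQ_apply, Submodule.mapQ_apply, Submodule.Quotient.mk_eq_zero] at hy
      obtain ⟨z, -, hz⟩ := hy
      replace hz : r ^ (k + 1 + 1) • z = r ^ (k + 1) • y := hz
      rw [pow_succ, ← smul_smul] at hz
      rw [Submodule.mkQ_apply, Submodule.Quotient.mk_eq_zero, ← h.1.pow (k + 1) hz]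
      exact Submodule.smul_mem_pointwise_smul _ _ _ trivial
    · intro y
      obtain ⟨y, rfl⟩ := Submodule.mkQ_surjective _ y
      rw [Submodule.mkQ_apply, Submodule.mapQ_apply, LinearMap.id_apply,
        Submodule.Quotient.mk_eq_zero]
      constructor
      · rintro ⟨z, -, rfl⟩
        exact ⟨Submodule.Quotient.mk z, rfl⟩
      · rintro ⟨z, hz⟩
        obtain ⟨z, rfl⟩ := Submodule.mkQ_surjective _ z
        rw [Submodule.mkQ_apply, Submodule.mapQ_apply, Submodule.Quotient.eq] at hz
        have h1 : r ^ (k + 1) • z - y ∈ r ^ (k + 1) • (⊤ : Submodule R M) := hle hz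
        have h2 : r ^ (k + 1) • z ∈ r ^ (k + 1) • (⊤ : Submodule R M) :=
          Submodule.smul_mem_pointwise_smul _ _ _ trivial
        simpa using sub_mem h2 h1
    · intro y
      obtain ⟨y, rfl⟩ := Submodule.mkQ_surjective _ y
      exact ⟨Submodule.Quotient.mk y, rfl⟩

/-- Once the head is replaced by its power, the tail is still weakly regular on the new quotient, so
its entries can be replaced there in turn, without reordering. -/
theorem map_pow {M : Type*} [AddCommGroup M] [Module R M] {l : List R}
    (h : IsWeaklyRegular M l) (k : ℕ) : IsWeaklyRegular M (l.map (· ^ (k + 1))) := by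
  induction l generalizing M with
  | nil => exact .nil R M
  | cons r l ih =>
    have h1 := h.cons_pow k
    rw [isWeaklyRegular_cons_iff] at h1
    exact .cons h1.1 (ih h1.2)

end RingTheory.Sequence.IsWeaklyRegular

/-- A basis vector and its coordinate function make `A` a direct summand of `M`. -/
theorem isWeaklyRegular_self_of_free {A : Type u} [CommRing A] {M : Type v} [AddCommGroup M]
    [Module A M] [Module.Free A M] [Nontrivial M] {l : List A}
    (h : RingTheory.Sequence.IsWeaklyRegular M l) : RingTheory.Sequence.IsWeaklyRegular A l := by
  let b := Module.Free.chooseBasis A M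
  obtain ⟨i⟩ := b.index_nonempty
  refine h.of_leftInverse (LinearMap.toSpanSingleton A M (b i)) (b.coord i) ?_
  ext
  simp

/-! ## Fitting ideals of composites and of homotheties -/

section Fitting

variable {A : Type u} [CommRing A] {M N P : Type*}
    [AddCommGroup M] [Module A M] [Module.Free A M] [Module.Finite A M]
    [AddCommGroup N] [Module A N] [Module.Free A N] [Module.Finite A N]
    [AddCommGroup P] [Module A P] [Module.Free A P] [Module.Finite A P]

theorem fittingIdeal_comp_le_right (t : ℕ) (g : N →ₗ[A] P) (f : M →ₗ[A] N) :
    fittingIdeal t (g ∘ₗ f) ≤ fittingIdeal t f := by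
  classical
  unfold fittingIdeal
  rw [LinearMap.toMatrix_comp _ (Module.Free.chooseBasis A N)]
  exact minorIdeal_mul_le_right t _ _

theorem fittingIdeal_comp_le_left (t : ℕ) (g : N →ₗ[A] P) (f : M →ₗ[A] N) :
    fittingIdeal t (g ∘ₗ f) ≤ fittingIdeal t g := by
  classical
  unfold fittingIdeal
  rw [LinearMap.toMatrix_comp _ (Module.Free.chooseBasis A N)]
  exact minorIdeal_mul_le_left t _ _

theorem pow_finrank_mem_fittingIdeal_smul_id [Nontrivial A] (a : A) :
    a ^ Module.finrank A M ∈ fittingIdeal (Module.finrank A M) (a • (LinearMap.id : M →ₗ[A] M)) := by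
  let b := Module.finBasis A M
  rw [fittingIdeal_eq_minorIdeal b b]
  convert det_submatrix_mem_minorIdeal _ _ id id
  simp

end Fitting

/-! ## Ranks in the total complex -/

/-- Removing `s` gives a bijection with the `k`-subsets of `S ∖ {s}`. This counts the blocks of the
minor in direction `s`. -/
theorem card_subsets_card_eq_mem {S : Type w} [Fintype S] [DecidableEq S] (s : S) (k : ℕ) :
    Fintype.card {T : Finset S // T.card = k + 1 ∧ s ∈ T} = (Fintype.card S - 1).choose k := by
  have h : (Finset.univ.erase s : Finset S).card = Fintype.card S - 1 :=
    Finset.card_erase_of_mem (Finset.mem_univ s)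
  rw [← h, ← Finset.card_powersetCard, ← Fintype.card_coe]
  refine Fintype.card_congr ⟨fun T => ⟨T.1.erase s, ?_⟩, fun U => ⟨insert s U.1, ?_⟩, ?_, ?_⟩
  · rw [Finset.mem_powersetCard]
    exact ⟨Finset.erase_subset_erase _ (Finset.subset_univ _),
      by rw [Finset.card_erase_of_mem T.2.2, T.2.1]; rfl⟩
  · obtain ⟨h1, h2⟩ := Finset.mem_powersetCard.1 U.2
    have : s ∉ U.1 := fun h => by simpa using h1 h
    exact ⟨by rw [Finset.card_insert_of_notMem this, h2], Finset.mem_insert_self _ _⟩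
  · rintro ⟨T, -, hT⟩
    simp [Finset.insert_erase hT]
  · rintro ⟨U, hU⟩
    have : s ∉ U := fun h => by simpa using (Finset.mem_powersetCard.1 hU).1 h
    simp [Finset.erase_insert this]

/-- Descending induction on `i`: splitting off the term `j = i + 1` flips the signs of the rest, and
Pascal's rule does the subtraction. -/
theorem sum_Icc_neg_one_pow_mul_choose (n i : ℕ) (hi : i ≤ n) :
    ∑ j ∈ Finset.Icc (i + 1) (n + 1), (-1 : ℤ) ^ (j - (i + 1)) * ((n + 1).choose j : ℤ) =
      n.choose i := by
  induction hi using Nat.decreasingInduction with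
  | self => simp
  | of_succ i hi ih =>
    rw [← Finset.add_sum_Ioc_eq_sum_Icc (by omega)]
    have : ∑ j ∈ Finset.Ioc (i + 1) (n + 1), (-1 : ℤ) ^ (j - (i + 1)) * ((n + 1).choose j : ℤ) =
        - ∑ j ∈ Finset.Icc (i + 1 + 1) (n + 1),
          (-1 : ℤ) ^ (j - (i + 1 + 1)) * ((n + 1).choose j : ℤ) := by
      rw [← Finset.sum_neg_distrib]
      refine Finset.sum_congr (by ext; simp) fun j hj => ?_
      obtain ⟨d, rfl⟩ := Nat.exists_eq_add_of_le (Finset.mem_Icc.1 hj).1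
      rw [show i + 1 + 1 + d - (i + 1) = d + 1 by omega, Nat.add_sub_cancel_left]
      ring
    rw [this, ih, Nat.choose_succ_succ]
    simp

namespace Cube

theorem finrank_totX {A : Type u} [CommRing A] [Nontrivial A] {S : Type w} [Fintype S]
    (x : Cube S (ModuleCat.{v} A))
    [∀ T, Module.Free A (x.vertex T)] [∀ T, Module.Finite A (x.vertex T)]
    {m : ℕ} (hrank : ∀ T, Module.finrank A (x.vertex T) = m) (k : ℕ) :
    Module.finrank A (x.TotX k) = (Fintype.card S).choose k * m := by
  classical
  rw [Module.finrank_directSum]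
  simp [hrank, Fintype.card_finset_len]

theorem altRank_tot {A : Type u} [CommRing A] [Nontrivial A] {S : Type w} [Fintype S]
    [DecidableEq S] (α : S ≃ Fin (Fintype.card S)) (x : Cube S (ModuleCat.{v} A))
    [∀ T, Module.Free A (x.vertex T)] [∀ T, Module.Finite A (x.vertex T)]
    {m : ℕ} (hrank : ∀ T, Module.finrank A (x.vertex T) = m) {k : ℕ}
    (hk : k + 1 ≤ Fintype.card S) :
    altRank (x.Tot α) (Fintype.card S) (k + 1) = ((Fintype.card S - 1).choose k * m : ℕ) := by
  have h : ∀ j, Module.finrank A ((x.Tot α).X j) = (Fintype.card S).choose j * m :=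
    x.finrank_totX hrank
  obtain ⟨n, hn⟩ := Nat.exists_eq_add_of_le' (show 1 ≤ Fintype.card S by omega)
  rw [hn] at h hk ⊢
  simp only [altRank, h]
  rw [Nat.add_sub_cancel, Nat.cast_mul, ← sum_Icc_neg_one_pow_mul_choose n k (by omega),
    Finset.sum_mul]
  exact Finset.sum_congr rfl fun j _ => by push_cast; ring

/-! ## The boundary of the total complex near a direction `s` -/

section Minor

variable {A : Type u} [CommRing A] {S : Type w} [Fintype S] [DecidableEq S]
    (α : S ≃ Fin (Fintype.card S)) (x : Cube S (ModuleCat.{v} A))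

/-- The inclusion into degree `k + 1` of the total complex of the vertices `x_T` with `s ∈ T`. -/
noncomputable def starIncl (s : S) (k : ℕ) :
    (Π T : {T : Finset S // T.card = k + 1 ∧ s ∈ T}, x.vertex T.1) →ₗ[A] x.TotX (k + 1) :=
  ∑ T : {T : Finset S // T.card = k + 1 ∧ s ∈ T},
    DirectSum.lof A {T : Finset S // T.card = k + 1} (fun U => x.vertex U.1) ⟨T.1, T.2.1⟩ ∘ₗ
      LinearMap.proj T

variable {x} in
/-- The signed adjugate maps in direction `s`, from degree `k` of the total complex to the
vertices `x_T` with `s ∈ T`. -/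
noncomputable def adjProj (𝔄 : CubeAdjugate A x) (s : S) (k : ℕ) :
    x.TotX k →ₗ[A] (Π T : {T : Finset S // T.card = k + 1 ∧ s ∈ T}, x.vertex T.1) :=
  LinearMap.pi fun T => totSign A α T.1 s • ((𝔄.dstar T.1 s T.2.2).hom ∘ₗ
    DirectSum.component A {T : Finset S // T.card = k} (fun U => x.vertex U.1)
      ⟨T.1.erase s, by rw [Finset.card_erase_of_mem T.2.2, T.2.1]; rfl⟩)

variable {x} in
theorem adjProj_comp_totD_comp_starIncl (𝔄 : CubeAdjugate A x) (s : S) (k : ℕ) :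
    adjProj α 𝔄 s k ∘ₗ x.totD α k ∘ₗ x.starIncl s k = 𝔄.a s • LinearMap.id := by
  refine LinearMap.pi_ext' fun T => LinearMap.ext fun v => funext fun V => ?_
  have h1 : x.starIncl s k (Pi.single T v) = DirectSum.lof A {T : Finset S // T.card = k + 1}
      (fun U => x.vertex U.1) ⟨T.1, T.2.1⟩ v := by
    rw [starIncl, LinearMap.sum_apply, Finset.sum_eq_single T]
    · simp
    · intro U _ hU
      simp [Pi.single_eq_of_ne hU]
    · simp
  simp only [LinearMap.comp_apply, LinearMap.coe_single, h1, totD, DirectSum.toModule_lof,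
    LinearMap.sum_apply, map_sum, adjProj, LinearMap.pi_apply, LinearMap.smul_apply,
    map_smul, LinearMap.id_apply, Pi.smul_apply]
  rw [Finset.sum_eq_single ⟨s, T.2.2⟩]
  -- Only `j = s` contributes. On the diagonal the sign occurs twice and cancels, leaving `d_T^{s*}
  -- d_T^s = a_s`; off it, `V ∖ {s} = T ∖ {s}` would force `V = T`.
  · by_cases hTV : V = T
    · subst hTV
      rw [Pi.single_eq_same, DirectSum.component.lof_self, smul_smul]
      have h2 := congrArg (fun f => f.hom v) (𝔄.bdry_dstar V.1 s V.2.2)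
      have h3 : totSign A α V.1 s * totSign A α V.1 s = 1 := by
        rw [totSign, ← pow_add, ← two_mul, pow_mul]
        simp
      rw [h3, one_smul]
      exact h2
    · rw [Pi.single_eq_of_ne hTV, smul_zero, DirectSum.component.of, dif_neg, map_zero, smul_zero,
        smul_zero]
      intro h
      apply hTV
      have := congrArg (fun U => insert s U.1) h
      simp only [Finset.insert_erase V.2.2, Finset.insert_erase T.2.2] at this
      exact (Subtype.ext this).symm
  -- For `j ≠ s` the target `T ∖ {j}` contains `s`, so it is not of the form `V ∖ {s}`.
  · rintro ⟨j, hj⟩ - hjs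
    rw [DirectSum.component.of, dif_neg, map_zero, smul_zero, smul_zero]
    intro h
    have h2 : s ∈ T.1.erase j := Finset.mem_erase.2 ⟨fun e => hjs (Subtype.ext e.symm), T.2.2⟩
    rw [show T.1.erase j = V.1.erase s from congrArg Subtype.val h] at h2
    simp at h2
  · simp

variable {x} in
-- The determinant of `a_s • id` is a maximal minor of a composite through `totD`, and the Fitting
-- ideal of a composite lies in that of each factor.
theorem pow_mem_fittingIdeal_totD [Nontrivial A]
    [∀ T, Module.Free A (x.vertex T)] [∀ T, Module.Finite A (x.vertex T)]
    {m : ℕ} (hrank : ∀ T, Module.finrank A (x.vertex T) = m)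
    (𝔄 : CubeAdjugate A x) (s : S) (k : ℕ) :
    𝔄.a s ^ ((Fintype.card S - 1).choose k * m) ∈
      fittingIdeal ((Fintype.card S - 1).choose k * m) (x.totD α k) := by
  have hfin : Module.finrank A
      (Π T : {T : Finset S // T.card = k + 1 ∧ s ∈ T}, x.vertex T.1) =
      (Fintype.card S - 1).choose k * m := by
    rw [Module.finrank_pi_fintype, ← card_subsets_card_eq_mem s k]
    simp [hrank]
  have h := pow_finrank_mem_fittingIdeal_smul_id (A := A)
    (M := Π T : {T : Finset S // T.card = k + 1 ∧ s ∈ T}, x.vertex T.1) (𝔄.a s)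
  rw [hfin, ← adjProj_comp_totD_comp_starIncl α 𝔄 s k] at h
  exact fittingIdeal_comp_le_left _ _ _ (fittingIdeal_comp_le_right _ _ _ h)

end Minor

end Cube

/-! ### Grade of the Fitting ideals -/

theorem le_idealGrade {A : Type u} [CommRing A] {I : Ideal A} {n : ℕ} (f : Fin n → A)
    (hf : ∀ i, f i ∈ I) (h : IsRegSeq A (List.ofFn f)) : (n : ℕ∞) ≤ idealGrade I :=
  le_iSup₂_of_le (f := fun (n : ℕ) (_ : n ∈ regSeqLengths I) => (n : ℕ∞)) n ⟨f, hf, h⟩ le_rfl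

theorem proposition5p14 {A : Type u} [CommRing A] {S : Type w} [Fintype S] [DecidableEq S]
    (x : Cube S (ModuleCat.{v} A))
    [∀ T, Module.Free A (x.vertex T)] [∀ T, Module.Finite A (x.vertex T)]
    (m : ℕ) (hm : 0 < m) (hrank : ∀ T, Module.finrank A (x.vertex T) = m)
    (hreg : ∃ 𝔄 : CubeAdjugate A x, 𝔄.IsRegular)
    (α : S ≃ Fin (Fintype.card S)) :
    GradeCondition (x.Tot α) (Fintype.card S) := by
  obtain ⟨𝔄, h𝔄⟩ := hreg
  intro i hi hin
  obtain ⟨k, rfl⟩ := Nat.exists_eq_add_of_le' hi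
  obtain ⟨hunit, hweak⟩ := h𝔄 ∅ α.symm
  -- In the zero ring every element is a unit, whereas `a` has a non-unit member because `k < n`.
  have : Nontrivial A := ⟨𝔄.a (α.symm ⟨k, hin⟩), 1, fun h =>
    hunit _ (List.mem_ofFn.2 ⟨⟨k, hin⟩, rfl⟩) (h ▸ isUnit_one)⟩
  have : Nontrivial (x.vertex ∅) :=
    Module.nontrivial_of_finrank_pos (R := A) (by rw [hrank]; exact hm)
  -- The exponent is positive since `k ≤ n - 1` and `m > 0`; this keeps the powers non-units.
  obtain ⟨r, hr⟩ : ∃ r, (Fintype.card S - 1).choose k * m = r + 1 :=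
    Nat.exists_eq_add_of_le' (Nat.mul_pos (Nat.choose_pos (by omega)) hm)
  rw [Cube.altRank_tot α x hrank hin, Int.toNat_natCast]
  -- The regular sequence has length `n`, which is at least `k + 1`.
  refine le_trans (by exact_mod_cast hin)
    (le_idealGrade (fun i => 𝔄.a (α.symm i) ^ (r + 1)) (fun i => ?_) ⟨?_, ?_⟩)
  · have hd : ((x.Tot α).d (k + 1) k).hom = x.totD α k :=
      congrArg ModuleCat.Hom.hom (ChainComplex.of_d (fun k => ModuleCat.of A (x.TotX k))
        (fun k => ModuleCat.ofHom (x.totD α k)) k)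
    change _ ∈ fittingIdeal _ ((x.Tot α).d (k + 1) k).hom
    rw [hd, ← hr]
    exact Cube.pow_mem_fittingIdeal_totD α hrank 𝔄 (α.symm i) k
  · rintro f hf
    obtain ⟨i, rfl⟩ := List.mem_ofFn.1 hf
    rw [isUnit_pow_iff (by omega)]
    exact hunit _ (List.mem_ofFn.2 ⟨i, rfl⟩)
  · have h := (isWeaklyRegular_self_of_free hweak).map_pow r
    rwa [List.map_ofFn] at h
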